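/- Let $d\ge 1$ and $K\ge 0$ be integers, let $p\in[1,\infty)$, and let $\beta\le 1$ and $Q$ be real numbers. Let $f:[0,1]^d\to\mathbb R$ satisfy $$|f(\mathbf x)-f(\mathbf y)|\le Q\,|\mathbf x-\mathbf y|_\infty^{\beta}\qquad\text{for all distinct }\mathbf x,\mathbf y\in[0,1]^d,$$ where $|\cdot|_\infty$ is the maximum norm. Write $\|\cdot\|_q=\|\cdot\|_{L^q([0,1]^d)}$ with respect to Lebesgue measure. (If $\beta\le 0$, $f$ need not be measurable; the integral defining $\|\cdot\|_p$ is then read as a lower integral.) A ReLU network with architecture $(L,(p_0,\dots,p_{L+1}))$ is a function $\mathbb R^{p_0}\to\mathbb R^{p_{L+1}}$ of the form $\mathbf x\mapsto A_{L}\,\mathbf y_{L}+\mathbf b_{L}$, where $\mathbf y_0=\mathbf x$ and $\mathbf y_{\ell+1}=\sigma(A_{\ell}\,\mathbf y_{\ell}+\mathbf b_{\ell})$ for $0\le \ell<L$, with $\sigma(t)=\max(t,0)$ applied componentwise, $A_\ell\in\mathbb R^{p_{\ell+1}\times p_\ell}$ and $\mathbf b_\ell\in\mathbb R^{p_{\ell+1}}$.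 Its network weights are all entries of the $A_\ell$ and $\mathbf b_\ell$. Then there exists a ReLU network $\widetilde f$ with $2K+3$ hidden layers and architecture $$\big(2K+3,\ (d,\underbrace{4d,\dots,4d}_{2K\text{ times}},d,1,2^{Kd}+1,1)\big),$$ all of whose network weights are bounded in absolute value by $$2\,\max(K,\|f\|_\infty)\,2^{K\max(d,\,p\beta)},$$ such that $$\|f-\widetilde f\|_{p}\le\big(16\,Q+2\|f\|_\infty\big)\,2^{-\beta K}.$$ -/

import Mathlib

open MeasureTheory
open scoped ENNReal

/-- The unit cube `[0,1]^d`. The norm of `Fin d → ℝ` is the maximum norm. -/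
def unitCube (d : ℕ) : Set (Fin d → ℝ) := Set.Icc 0 1

/-- The norm `‖f‖_{L^q([0,1]^d)}`, for `q ∈ [0,∞]`, as an extended nonnegative number. -/
noncomputable def cubeNorm {d : ℕ} (q : ℝ≥0∞) (f : (Fin d → ℝ) → ℝ) : ℝ≥0∞ :=
  eLpNorm f q (volume.restrict (unitCube d))

/-- `ReLUNet m n [p₁, …, p_L]` is the type of feedforward ReLU networks with `L` hidden layers and
architecture `(L, (n, p₁, …, p_L, m))`, given by their parameters. In every layer after the
input layer, each vertex has its own weight vector (a row of `A`) and its own shift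
(an entry of `b`). -/
inductive ReLUNet (m : ℕ) : ℕ → List ℕ → Type
  | output {n : ℕ} (A : Matrix (Fin m) (Fin n) ℝ) (b : Fin m → ℝ) : ReLUNet m n []
  | hidden {n k : ℕ} {ws : List ℕ} (A : Matrix (Fin k) (Fin n) ℝ) (b : Fin k → ℝ)
      (N : ReLUNet m k ws) : ReLUNet m n (k :: ws)

namespace ReLUNet

/-- The function computed by a network: each vertex of a hidden layer computes
`y ↦ max (a ⬝ y + b) 0`, each vertex of the output layer computes `y ↦ a ⬝ y + b`. -/
noncomputable def eval {m : ℕ} : {n : ℕ} → {ws : List ℕ} → ReLUNet m n ws →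
    (Fin n → ℝ) → (Fin m → ℝ)
  | _, _, output A b, x => fun i => (A.mulVec x) i + b i
  | _, _, hidden A b N, x => N.eval (fun i => max ((A.mulVec x) i + b i) 0)

/-- All parameters of the network (weights and shifts) are at most `B` in absolute value. -/
def WeightsBounded {m : ℕ} (B : ℝ) : {n : ℕ} → {ws : List ℕ} → ReLUNet m n ws → Prop
  | _, _, output A b => (∀ i j, |A i j| ≤ B) ∧ (∀ i, |b i| ≤ B)
  | _, _, hidden A b N => (∀ i j, |A i j| ≤ B) ∧ (∀ i, |b i| ≤ B) ∧ N.WeightsBounded B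

end ReLUNet

/-- The widths `4d, …, 4d, d, 1, 2^{Kd} + 1` of the hidden layers, where `4d` occurs `2K` times. -/
def hiddenWidths (d K : ℕ) : List ℕ :=
  List.replicate (2 * K) (4 * d) ++ [d, 1, 2 ^ (K * d) + 1]

/-- The number of hidden layers is `2K + 3`. -/
theorem length_hiddenWidths (d K : ℕ) : (hiddenWidths d K).length = 2 * K + 3 := by
  simp [hiddenWidths]

/-!
If `K = 0` or `β ≤ 0`, the bound is at least `2 * ‖f‖_∞` and the zero network does. Otherwise the
network approximates a function that is constant on the dyadic cells of side `2 ^ (-K)`.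

For a single coordinate `t ∈ [0, 1)` the binary digits are found by the doubling map: with
`y = fract (2 ^ k * t)`, the next digit is `1` iff `y ≥ 1 / 2`, and the next fractional part is
`2 * y` minus this digit. Two ReLU layers of steepness `T` replace the step function at `1 / 2` by a
ramp of width `1 / T ^ 2`, using three units per coordinate (`t`, `y` and the digit), so that `2 * K`
layers of width `4 * d` suffice for `K` digits in all coordinates. From them
`⌊2 ^ K * t⌋ = 2 ^ K * t - fract (2 ^ K * t)` is affine, the layer of width `1` combines the `d`
integers obtained into the number of the cell of `x`, written in base `2 ^ K`, and the last hidden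
layer is a piecewise linear interpolation of the values prescribed at the integers
(`ReLUNet.cellNet_eval`).

The digits are right unless some coordinate lies within `1 / T ^ 2` to the right of a dyadic
point. The interpolating function never exceeds its prescribed values in absolute value, so the
error on this exceptional set is at most `2 * ‖f‖_∞` (`ReLUNet.abs_cellNet_eval_le`), and with
`T = 2 ^ (K * max d (p * β))` the set has measure at most `d * 2 ^ K / T ^ 2 ≤ 2 ^ (-p * β * K)`
(`volume_exceptionalSet_rpow_le`). Off the exceptional set the error is at most
`Q * 2 ^ (-β * K)`, the oscillation of `f` on a cell (`exists_cell_values`).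
-/

namespace ReLUNet

/-! ### Networks acting coordinatewise -/

/-- The matrix applying `C` to each of `d` blocks of coordinates separately; `e` and `e'` say which
unit of a layer is which component of which block. -/
def coordMatrix {n k a b d : ℕ} (e : Fin n ≃ Fin a × Fin d) (e' : Fin k ≃ Fin b × Fin d)
    (C : Matrix (Fin b) (Fin a) ℝ) : Matrix (Fin k) (Fin n) ℝ :=
  fun p q => if (e' p).2 = (e q).2 then C (e' p).1 (e q).1 else 0

/-- The vector of a layer whose `i`-th block has components `s i`. -/
def coordState {n a d : ℕ} (e : Fin n ≃ Fin a × Fin d) (s : Fin d → Fin a → ℝ) : Fin n → ℝ :=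
  fun q => s (e q).2 (e q).1

theorem coordMatrix_mulVec {n k a b d : ℕ} (e : Fin n ≃ Fin a × Fin d)
    (e' : Fin k ≃ Fin b × Fin d) (C : Matrix (Fin b) (Fin a) ℝ) (s : Fin d → Fin a → ℝ)
    (p : Fin k) :
    (coordMatrix e e' C).mulVec (coordState e s) p = C.mulVec (s (e' p).2) (e' p).1 := by
  simp only [Matrix.mulVec, dotProduct, coordMatrix, coordState]
  rw [e.sum_comp (fun q => (if (e' p).2 = q.2 then C (e' p).1 q.1 else 0) * s q.2 q.1),
    Fintype.sum_prod_type]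
  simp [ite_mul, Finset.sum_ite_eq]

/-- A hidden layer applying the same affine map `y ↦ C y + c`, then the ReLU, to each block. -/
def coordLayer {m n k a b d : ℕ} {ws : List ℕ} (e : Fin n ≃ Fin a × Fin d)
    (e' : Fin k ≃ Fin b × Fin d) (C : Matrix (Fin b) (Fin a) ℝ) (c : Fin b → ℝ)
    (N : ReLUNet m k ws) : ReLUNet m n (k :: ws) :=
  hidden (coordMatrix e e' C) (fun p => c (e' p).1) N

theorem coordLayer_eval {m n k a b d : ℕ} {ws : List ℕ} (e : Fin n ≃ Fin a × Fin d)
    (e' : Fin k ≃ Fin b × Fin d) (C : Matrix (Fin b) (Fin a) ℝ) (c : Fin b → ℝ)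
    (N : ReLUNet m k ws) (s : Fin d → Fin a → ℝ) :
    (coordLayer e e' C c N).eval (coordState e s) =
      N.eval (coordState e' fun i j => max (C.mulVec (s i) j + c j) 0) := by
  simp only [coordLayer, eval, coordMatrix_mulVec]
  rfl

theorem coordLayer_weightsBounded {m n k a b d : ℕ} {ws : List ℕ} {e : Fin n ≃ Fin a × Fin d}
    {e' : Fin k ≃ Fin b × Fin d} {C : Matrix (Fin b) (Fin a) ℝ} {c : Fin b → ℝ}
    {N : ReLUNet m k ws} {B : ℝ} (hC : ∀ i j, |C i j| ≤ B) (hc : ∀ i, |c i| ≤ B)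
    (hB : 0 ≤ B) (hN : N.WeightsBounded B) : (coordLayer e e' C c N).WeightsBounded B := by
  refine ⟨fun i j => ?_, fun i => hc _, hN⟩
  simp only [coordMatrix]
  split_ifs
  · exact hC _ _
  · simpa using hB

/-- The network of any architecture with all parameters zero. -/
def zeroNet (m : ℕ) : (n : ℕ) → (ws : List ℕ) → ReLUNet m n ws
  | _, [] => output 0 0
  | _, k :: ws => hidden 0 0 (zeroNet m k ws)

theorem zeroNet_eval (m : ℕ) (n : ℕ) (ws : List ℕ) (x : Fin n → ℝ) :
    (zeroNet m n ws).eval x = 0 := by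
  induction ws generalizing n with
  | nil => ext i; simp [zeroNet, eval]
  | cons k ws ih => simp [zeroNet, eval, ih]

theorem zeroNet_weightsBounded (m : ℕ) (n : ℕ) (ws : List ℕ) {B : ℝ} (hB : 0 ≤ B) :
    (zeroNet m n ws).WeightsBounded B := by
  induction ws generalizing n with
  | nil => simp [zeroNet, WeightsBounded, hB]
  | cons k ws ih => simp [zeroNet, WeightsBounded, hB, ih]

/-! ### Piecewise linear interpolation at the integers -/

/-- The piecewise linear function with value `v n` at `n = 0, …, L`, constant outside `[0, L]`. -/
noncomputable def interp (v : ℕ → ℝ) (L : ℕ) (t : ℝ) : ℝ :=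
  v 0 + ∑ m ∈ Finset.range L, (v (m + 1) - v m) * (max (t - m) 0 - max (t - (m + 1)) 0)

theorem interp_succ (v : ℕ → ℝ) (L : ℕ) (t : ℝ) : interp v (L + 1) t =
    interp v L t + (v (L + 1) - v L) * (max (t - L) 0 - max (t - (L + 1)) 0) := by
  simp [interp, Finset.sum_range_succ, add_assoc]

theorem interp_of_le (v : ℕ → ℝ) (L : ℕ) {t : ℝ} (ht : L ≤ t) : interp v L t = v L := by
  induction L with
  | zero => simp [interp]
  | succ L ih =>
    push_cast at ht
    rw [interp_succ, ih (by linarith), max_eq_left (by linarith), max_eq_left (by linarith)]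
    ring

theorem interp_natCast (v : ℕ → ℝ) {L n : ℕ} (hn : n ≤ L) : interp v L n = v n := by
  induction L, hn using Nat.le_induction with
  | base => exact interp_of_le v n le_rfl
  | succ L hL ih =>
    have : (n : ℝ) ≤ L := by exact_mod_cast hL
    rw [interp_succ, ih, max_eq_right (by linarith), max_eq_right (by linarith)]
    ring

theorem abs_interp_le {v : ℕ → ℝ} {F : ℝ} (hv : ∀ n, |v n| ≤ F) (L : ℕ) (t : ℝ) :
    |interp v L t| ≤ F := by
  induction L with
  | zero => simpa [interp] using hv 0
  | succ L ih =>
    rw [interp_succ]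
    rcases le_total t L with h | h
    · rwa [max_eq_right (by linarith), max_eq_right (by linarith), sub_self, mul_zero, add_zero]
    · rw [interp_of_le v L h, max_eq_left (by linarith)]
      have h1 := abs_le.1 (hv L)
      have h2 := abs_le.1 (hv (L + 1))
      rcases le_total t (L + 1) with h' | h'
      · rw [max_eq_right (by linarith), abs_le]
        constructor <;> nlinarith
      · rw [max_eq_left (by linarith), abs_le]
        constructor <;> linarith

/-- The change of slope of `interp v L` at `m`. -/
def slopeChange (v : ℕ → ℝ) (L m : ℕ) : ℝ :=
  (if m < L then v (m + 1) - v m else 0) - (if 0 < m then v m - v (m - 1) else 0)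

theorem abs_slopeChange_le {v : ℕ → ℝ} {F : ℝ} (hv : ∀ n, |v n| ≤ F) (L m : ℕ) :
    |slopeChange v L m| ≤ 4 * F := by
  have h1 := abs_le.1 (hv (m + 1))
  have h2 := abs_le.1 (hv m)
  have h3 := abs_le.1 (hv (m - 1))
  rw [slopeChange, abs_le]
  split_ifs <;> constructor <;> linarith

/-- Summation by parts: `interp v L` needs only `L + 1` ReLU units. -/
theorem interp_eq_sum_slopeChange (v : ℕ → ℝ) (L : ℕ) (t : ℝ) :
    interp v L t = v 0 + ∑ m ∈ Finset.range (L + 1), slopeChange v L m * max (t - m) 0 := by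
  simp only [interp, slopeChange, sub_mul, mul_sub, Finset.sum_sub_distrib]
  congr 2
  · rw [Finset.sum_range_succ]
    simp only [lt_irrefl, if_false, zero_mul, add_zero]
    rw [← Finset.sum_sub_distrib]
    refine Finset.sum_congr rfl fun m hm => ?_
    rw [if_pos (Finset.mem_range.1 hm)]
    ring
  · rw [Finset.sum_range_succ', ← Finset.sum_sub_distrib]
    simp [sub_mul]

/-- The network with one hidden layer computing `interp v L`. -/
noncomputable def interpNet (v : ℕ → ℝ) (L : ℕ) : ReLUNet 1 1 [L + 1] :=
  hidden (fun _ _ => 1) (fun m => -m) (output (fun _ m => slopeChange v L m) fun _ => v 0)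

theorem interpNet_eval (v : ℕ → ℝ) (L : ℕ) (y : Fin 1 → ℝ) :
    (interpNet v L).eval y 0 = interp v L (y 0) := by
  simp only [interp_eq_sum_slopeChange, Finset.sum_range]
  simp [interpNet, eval, Matrix.mulVec, dotProduct, sub_eq_add_neg, add_comm (v 0)]

theorem interpNet_weightsBounded {v : ℕ → ℝ} {L : ℕ} {F B : ℝ} (hv : ∀ n, |v n| ≤ F)
    (hF : 4 * F ≤ B) (hL : (L : ℝ) ≤ B) (h1 : 1 ≤ B) : (interpNet v L).WeightsBounded B := by
  have hF0 : 0 ≤ F := (abs_nonneg _).trans (hv 0)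
  refine ⟨fun _ _ => by simpa using h1, fun m => ?_,
    fun _ m => (abs_slopeChange_le hv L m).trans hF, fun _ => (hv 0).trans (by linarith)⟩
  have : ((m : ℕ) : ℝ) ≤ L := by exact_mod_cast Nat.lt_succ_iff.1 m.2
  simpa using this.trans hL

/-! ### Extraction of binary digits -/

/-- `t` is not within `δ` to the right of one of the points `1/2^K, …, 2^K/2^K`. -/
def AwayFromGrid (K : ℕ) (δ t : ℝ) : Prop :=
  ∀ j < 2 ^ K, t ∉ Set.Ico (((j + 1 : ℕ) : ℝ) / 2 ^ K) (((j + 1 : ℕ) : ℝ) / 2 ^ K + δ)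

theorem AwayFromGrid.lt_one {K : ℕ} {δ t : ℝ} (h : AwayFromGrid K δ t) (hδ : 0 < δ)
    (ht1 : t ≤ 1) : t < 1 := by
  refine lt_of_le_of_ne ht1 ?_
  rintro rfl
  refine h (2 ^ K - 1) (Nat.sub_lt (by positivity) one_pos) ?_
  rw [Nat.sub_add_cancel Nat.one_le_two_pow]
  have : (2 : ℝ) ^ K ≠ 0 := by positivity
  simp [hδ]

/-- A digit is uncertain only immediately to the right of a dyadic point. -/
theorem AwayFromGrid.fract_pow_mul {K : ℕ} {δ t : ℝ} (h : AwayFromGrid K δ t) (ht0 : 0 ≤ t)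
    (hδ : 0 < δ) (ht1 : t ≤ 1) {k : ℕ} (hk : k < K) :
    Int.fract (2 ^ k * t) < 1 / 2 ∨ 1 / 2 + δ ≤ Int.fract (2 ^ k * t) := by
  by_contra! hc
  obtain ⟨h1, h2⟩ := hc
  have ht := h.lt_one hδ ht1
  obtain ⟨r, rfl⟩ := Nat.exists_eq_add_of_lt hk
  have hk0 : (0 : ℝ) < 2 ^ k := by positivity
  have hr0 : (0 : ℝ) < 2 ^ r := by positivity
  set n := ⌊2 ^ k * t⌋₊ with hn
  have hfr : Int.fract (2 ^ k * t) = 2 ^ k * t - n := by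
    rw [hn, natCast_floor_eq_intCast_floor (by positivity), Int.self_sub_floor]
  rw [hfr] at h1 h2
  have hn1 : n + 1 ≤ 2 ^ k := by
    have : (n : ℝ) < 2 ^ k := by nlinarith
    exact_mod_cast this
  have hj : (2 * n + 1) * 2 ^ r - 1 + 1 = (2 * n + 1) * 2 ^ r :=
    Nat.sub_add_cancel (Nat.mul_pos (by omega) (by positivity))
  -- `t` lies to the right of `(n + 1 / 2) / 2 ^ k = ((2 * n + 1) * 2 ^ r) / 2 ^ (k + r + 1)`.
  refine h ((2 * n + 1) * 2 ^ r - 1) ?_ ?_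
  · have : (2 * n + 1) * 2 ^ r ≤ 2 ^ (k + 1) * 2 ^ r := by
      gcongr
      rw [pow_succ]; omega
    rw [← pow_add] at this
    have e : k + r + 1 = k + 1 + r := by ring
    rw [e]; omega
  · rw [hj]
    have e : (((2 * n + 1) * 2 ^ r : ℕ) : ℝ) / 2 ^ (k + r + 1) = (n + 1 / 2) / 2 ^ k := by
      push_cast
      field_simp
      ring
    rw [e]
    constructor
    · rw [div_le_iff₀ hk0]; linarith
    · rw [div_add' _ _ _ hk0.ne', lt_div_iff₀ hk0]
      have : (1 : ℝ) ≤ 2 ^ k := one_le_pow₀ one_le_two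
      nlinarith

/-- The components kept for one coordinate `t` once its first `k + 1` binary digits are known: `t`,
the fractional part of `2 ^ k * t`, the complement of the digit number `k`, and an idle unit. -/
noncomputable def digitState (k : ℕ) (t : ℝ) : Fin 4 → ℝ :=
  ![t, Int.fract (2 ^ k * t), if Int.fract (2 ^ k * t) < 1 / 2 then 1 else 0, 0]

theorem digitState_recurrence (k : ℕ) (t : ℝ) :
    2 * digitState k t 1 - 1 + digitState k t 2 = Int.fract (2 ^ (k + 1) * t) := by
  have h0 := Int.fract_nonneg (2 ^ k * t)
  have h1 := Int.fract_lt_one (2 ^ k * t)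
  have e := Int.self_sub_floor (2 ^ k * t)
  simp only [digitState, Matrix.cons_val]
  symm
  rw [Int.fract_eq_iff]
  split_ifs with h
  · refine ⟨by linarith, by linarith, 2 * ⌊2 ^ k * t⌋, ?_⟩
    push_cast
    rw [← e, pow_succ]; ring
  · refine ⟨by linarith, by linarith, 2 * ⌊2 ^ k * t⌋ + 1, ?_⟩
    push_cast
    rw [← e, pow_succ]; ring

variable {d : ℕ}

/-- The units of a layer of width `d`, one for each coordinate. -/
def single (d : ℕ) : Fin d ≃ Fin 1 × Fin d := (Equiv.uniqueProd (Fin d) (Fin 1)).symm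

/-- The units of a layer of width `4 * d`, four for each coordinate. -/
def quadruple (d : ℕ) : Fin (4 * d) ≃ Fin 4 × Fin d := finProdFinEquiv.symm

/-- The layer finding, from `(t, y, u, _)` with `u = T * max (y - 1/2) 0`, the complement
`max (1 - T * u) 0` of the leading binary digit of `y`. -/
def thresholdLayer (T : ℝ) {ws : List ℕ} (N : ReLUNet 1 (4 * d) ws) :
    ReLUNet 1 (4 * d) (4 * d :: ws) :=
  coordLayer (quadruple d) (quadruple d)
    !![1, 0, 0, 0; 0, 1, 0, 0; 0, 0, -T, 0; 0, 0, 0, 0] ![0, 0, 1, 0] N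

/-- The two layers finding the first binary digit of each coordinate. -/
noncomputable def firstDigit (T : ℝ) {ws : List ℕ} (N : ReLUNet 1 (4 * d) ws) :
    ReLUNet 1 d (4 * d :: 4 * d :: ws) :=
  coordLayer (single d) (quadruple d) !![1; 1; T; 0] ![0, 0, -(T / 2), 0] (thresholdLayer T N)

/-- The two layers finding the next binary digit of each coordinate: the new fractional part is
`2 * y - 1 + v` if `y` is the old one and `v` the complement of the old digit. -/
noncomputable def nextDigit (T : ℝ) {ws : List ℕ} (N : ReLUNet 1 (4 * d) ws) :
    ReLUNet 1 (4 * d) (4 * d :: 4 * d :: ws) :=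
  coordLayer (quadruple d) (quadruple d)
    !![1, 0, 0, 0; 0, 2, 1, 0; 0, 2 * T, T, 0; 0, 0, 0, 0] ![0, -1, -(3 * T / 2), 0]
    (thresholdLayer T N)

/-- The layers finding `r` further binary digits of each coordinate. -/
noncomputable def moreDigits (T : ℝ) {ws : List ℕ} (N : ReLUNet 1 (4 * d) ws) :
    (r : ℕ) → ReLUNet 1 (4 * d) (List.replicate (2 * r) (4 * d) ++ ws)
  | 0 => N
  | r + 1 => nextDigit T (moreDigits T N r)

theorem thresholdLayer_eval {T : ℝ} (hT : 0 < T) {ws : List ℕ} (N : ReLUNet 1 (4 * d) ws)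
    {x : Fin d → ℝ} (hx : ∀ i, 0 ≤ x i) (k : ℕ)
    (h : ∀ i, Int.fract (2 ^ k * x i) < 1 / 2 ∨ 1 / 2 + (T ^ 2)⁻¹ ≤ Int.fract (2 ^ k * x i)) :
    (thresholdLayer T N).eval (coordState (quadruple d) fun i =>
      ![x i, Int.fract (2 ^ k * x i), max (T * Int.fract (2 ^ k * x i) - T / 2) 0, 0]) =
    N.eval (coordState (quadruple d) fun i => digitState k (x i)) := by
  rw [thresholdLayer, coordLayer_eval]
  congr 2
  funext i j
  fin_cases j
  · simp [Matrix.mulVec, dotProduct, Fin.sum_univ_four, digitState, hx i]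
  · simp [Matrix.mulVec, dotProduct, Fin.sum_univ_four, digitState]
  · simp only [Matrix.mulVec, dotProduct, Fin.sum_univ_four, digitState]
    simp
    rcases h i with h | h
    · rw [if_pos (by norm_num; linarith),
        max_eq_right (a := T * Int.fract (2 ^ k * x i) - T / 2) (by nlinarith)]
      simp
    · have hpos : 0 < (T ^ 2)⁻¹ := by positivity
      have hT2 : T ^ 2 * (T ^ 2)⁻¹ = 1 := mul_inv_cancel₀ (by positivity)
      rw [if_neg (by norm_num; linarith),
        max_eq_left (a := T * Int.fract (2 ^ k * x i) - T / 2) (by nlinarith), max_eq_right]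
      nlinarith [mul_le_mul_of_nonneg_left h (sq_nonneg T)]
  · simp [Matrix.mulVec, dotProduct, Fin.sum_univ_four, digitState]

theorem firstDigit_eval {T : ℝ} (hT : 0 < T) {ws : List ℕ} (N : ReLUNet 1 (4 * d) ws)
    {x : Fin d → ℝ} (hx : ∀ i, 0 ≤ x i) (hx1 : ∀ i, x i < 1)
    (h : ∀ i, Int.fract (2 ^ 0 * x i) < 1 / 2 ∨ 1 / 2 + (T ^ 2)⁻¹ ≤ Int.fract (2 ^ 0 * x i)) :
    (firstDigit T N).eval x = N.eval (coordState (quadruple d) fun i => digitState 0 (x i)) := by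
  rw [← thresholdLayer_eval hT N hx 0 h]
  have e : x = coordState (single d) fun i _ => x i := rfl
  conv_lhs => rw [e]
  rw [firstDigit, coordLayer_eval]
  congr 2
  funext i j
  have hf : Int.fract (2 ^ 0 * x i) = x i := by
    rw [pow_zero, one_mul, Int.fract_eq_self]
    exact ⟨hx i, hx1 i⟩
  rw [hf]
  fin_cases j <;> simp [Matrix.mulVec, dotProduct, hx i, sub_eq_add_neg]

theorem nextDigit_eval {T : ℝ} (hT : 0 < T) {ws : List ℕ} (N : ReLUNet 1 (4 * d) ws)
    {x : Fin d → ℝ} (hx : ∀ i, 0 ≤ x i) (k : ℕ)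
    (h : ∀ i, Int.fract (2 ^ (k + 1) * x i) < 1 / 2 ∨
      1 / 2 + (T ^ 2)⁻¹ ≤ Int.fract (2 ^ (k + 1) * x i)) :
    (nextDigit T N).eval (coordState (quadruple d) fun i => digitState k (x i)) =
      N.eval (coordState (quadruple d) fun i => digitState (k + 1) (x i)) := by
  rw [← thresholdLayer_eval hT N hx (k + 1) h, nextDigit, coordLayer_eval]
  congr 2
  funext i j
  rw [← digitState_recurrence]
  have h0 : digitState k (x i) 0 = x i := rfl
  have hfr := Int.fract_nonneg (2 ^ (k + 1) * x i)
  rw [← digitState_recurrence] at hfr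
  generalize digitState k (x i) = s at *
  fin_cases j
  · simp [Matrix.mulVec, dotProduct, Fin.sum_univ_four, h0, hx i]
  · simp [Matrix.mulVec, dotProduct, Fin.sum_univ_four]
    rw [max_eq_left (by linarith)]
    ring
  · simp [Matrix.mulVec, dotProduct, Fin.sum_univ_four]
    congr 1
    ring
  · simp [Matrix.mulVec, dotProduct, Fin.sum_univ_four]

theorem moreDigits_eval {T : ℝ} (hT : 0 < T) {ws : List ℕ} (N : ReLUNet 1 (4 * d) ws)
    {x : Fin d → ℝ} (hx : ∀ i, 0 ≤ x i) (r k : ℕ)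
    (h : ∀ l ≤ k + r, ∀ i, Int.fract (2 ^ l * x i) < 1 / 2 ∨
      1 / 2 + (T ^ 2)⁻¹ ≤ Int.fract (2 ^ l * x i)) :
    (moreDigits T N r).eval (coordState (quadruple d) fun i => digitState k (x i)) =
      N.eval (coordState (quadruple d) fun i => digitState (k + r) (x i)) := by
  induction r generalizing k with
  | zero => rfl
  | succ r ih =>
    have e : k + (r + 1) = k + 1 + r := by ring
    rw [e] at h ⊢
    rw [← ih (k + 1) h]
    exact nextDigit_eval hT _ hx k (h _ (by omega))

theorem thresholdLayer_weightsBounded {T B : ℝ} (hT : 1 ≤ T) (hB : 2 * T ≤ B) {ws : List ℕ}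
    {N : ReLUNet 1 (4 * d) ws} (hN : N.WeightsBounded B) :
    (thresholdLayer T N).WeightsBounded B := by
  have hT0 : |T| = T := abs_of_nonneg (by linarith)
  refine coordLayer_weightsBounded (fun i j => ?_) (fun i => ?_) (by linarith) hN
  · fin_cases i <;> fin_cases j <;> simp [hT0] <;> linarith
  · fin_cases i <;> simp <;> linarith

theorem firstDigit_weightsBounded {T B : ℝ} (hT : 1 ≤ T) (hB : 2 * T ≤ B) {ws : List ℕ}
    {N : ReLUNet 1 (4 * d) ws} (hN : N.WeightsBounded B) :
    (firstDigit T N).WeightsBounded B := by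
  have hT0 : |T| = T := abs_of_nonneg (by linarith)
  refine coordLayer_weightsBounded (fun i j => ?_) (fun i => ?_) (by linarith)
    (thresholdLayer_weightsBounded hT hB hN)
  · fin_cases i <;> fin_cases j <;> simp [hT0] <;> linarith
  · fin_cases i <;> simp [abs_div, hT0] <;> linarith

theorem moreDigits_weightsBounded {T B : ℝ} (hT : 1 ≤ T) (hB : 2 * T ≤ B) {ws : List ℕ}
    {N : ReLUNet 1 (4 * d) ws} (hN : N.WeightsBounded B) (r : ℕ) :
    (moreDigits T N r).WeightsBounded B := by
  have hT0 : |T| = T := abs_of_nonneg (by linarith)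
  induction r with
  | zero => exact hN
  | succ r ih =>
    refine coordLayer_weightsBounded (fun i j => ?_) (fun i => ?_) (by linarith)
      (thresholdLayer_weightsBounded hT hB ih)
    · fin_cases i <;> fin_cases j <;> simp [abs_mul, hT0] <;> linarith
    · fin_cases i <;> simp [abs_div, abs_mul, hT0] <;> linarith

/-! ### The network reading off the cell of a point -/

/-- The last layers: they compute `⌊2 ^ K * t⌋ = 2 ^ K * t - fract (2 ^ K * t)` for each coordinate,
combine these integers into one by reading them as digits in base `2 ^ K`, and look up the value
belonging to the result. -/
noncomputable def lookupNet (d K : ℕ) (v : ℕ → ℝ) :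
    ReLUNet 1 (4 * d) [d, 1, 2 ^ (K * d) + 1] :=
  coordLayer (quadruple d) (single d) !![2 ^ K, -2, -1, 0] ![1]
    (hidden (fun _ i => (2 ^ K) ^ (i : ℕ)) 0 (interpNet v (2 ^ (K * d))))

/-- The network taking the value `v n` on the cell with number `n`, up to errors close to the cell
boundaries. The case `K = 0` is a placeholder. -/
noncomputable def cellNet (d : ℕ) (T : ℝ) (v : ℕ → ℝ) : (K : ℕ) → ReLUNet 1 d (hiddenWidths d K)
  | 0 => zeroNet 1 d _
  | r + 1 => firstDigit T (moreDigits T (lookupNet d (r + 1) v) r)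

/-- The number of the dyadic cell of side `2 ^ (-K)` that contains `x`. -/
noncomputable def cellNumber (K : ℕ) (x : Fin d → ℝ) : ℕ :=
  ∑ i, ⌊2 ^ K * x i⌋₊ * (2 ^ K) ^ (i : ℕ)

theorem lookupNet_eval (r : ℕ) (v : ℕ → ℝ) {x : Fin d → ℝ} (hx : ∀ i, 0 ≤ x i) :
    (lookupNet d (r + 1) v).eval (coordState (quadruple d) fun i => digitState r (x i)) 0 =
      interp v (2 ^ ((r + 1) * d)) (cellNumber (r + 1) x) := by
  rw [lookupNet, coordLayer_eval]
  have e : (coordState (single d) fun (i : Fin d) (j : Fin 1) =>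
      max ((!![(2 : ℝ) ^ (r + 1), -2, -1, 0]).mulVec (digitState r (x i)) j + ![1] j) 0) =
      fun i => (⌊2 ^ (r + 1) * x i⌋₊ : ℝ) := by
    funext i
    have h1 : 0 ≤ 2 ^ (r + 1) * x i := mul_nonneg (by positivity) (hx i)
    have h2 := digitState_recurrence r (x i)
    have h3 : digitState r (x i) 0 = x i := rfl
    have h4 : (⌊2 ^ (r + 1) * x i⌋₊ : ℝ) =
        2 ^ (r + 1) * x i - Int.fract (2 ^ (r + 1) * x i) := by
      rw [Int.self_sub_fract, natCast_floor_eq_intCast_floor h1]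
    have h5 : (0 : ℝ) ≤ ⌊2 ^ (r + 1) * x i⌋₊ := Nat.cast_nonneg _
    change max (_ + _) _ = _
    rw [Subsingleton.elim ((single d) i).1 0, show ((single d) i).2 = i from rfl, ← max_eq_left h5,
      h4, ← h2]
    congr 1
    simp [Matrix.mulVec, dotProduct, Fin.sum_univ_four, h3]
    ring
  rw [e]
  simp only [eval]
  rw [interpNet_eval]
  congr 1
  simp only [Matrix.mulVec, dotProduct, cellNumber, Pi.zero_apply, add_zero]
  rw [max_eq_left (by positivity)]
  push_cast
  exact Finset.sum_congr rfl fun i _ => mul_comm _ _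

theorem cellNet_eval {K : ℕ} (hK : K ≠ 0) {T : ℝ} (hT : 0 < T) (v : ℕ → ℝ) {x : Fin d → ℝ}
    (hx : x ∈ unitCube d) (h : ∀ i, AwayFromGrid K (T ^ 2)⁻¹ (x i)) :
    (cellNet d T v K).eval x 0 = interp v (2 ^ (K * d)) (cellNumber K x) := by
  obtain ⟨r, rfl⟩ := Nat.exists_eq_succ_of_ne_zero hK
  have hδ : 0 < (T ^ 2)⁻¹ := by positivity
  have hx0 : ∀ i, 0 ≤ x i := hx.1
  have hf : ∀ l ≤ 0 + r, ∀ i, Int.fract (2 ^ l * x i) < 1 / 2 ∨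
      1 / 2 + (T ^ 2)⁻¹ ≤ Int.fract (2 ^ l * x i) := fun l hl i =>
    (h i).fract_pow_mul (hx0 i) hδ (hx.2 i) (by omega)
  rw [← lookupNet_eval r v hx0]
  change (firstDigit T (moreDigits T (lookupNet d (r + 1) v) r)).eval x 0 = _
  rw [firstDigit_eval hT _ hx0 (fun i => (h i).lt_one hδ (hx.2 i)) (hf 0 (by omega)),
    moreDigits_eval hT _ hx0 r 0 hf, zero_add]

/-- Every value of the network is one of an interpolating function, so that it is bounded even
where the binary digits are computed wrongly. -/
theorem abs_cellNet_eval_le {K : ℕ} (hK : K ≠ 0) (T : ℝ) {v : ℕ → ℝ} {F : ℝ}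
    (hv : ∀ n, |v n| ≤ F) (x : Fin d → ℝ) : |(cellNet d T v K).eval x 0| ≤ F := by
  obtain ⟨r, rfl⟩ := Nat.exists_eq_succ_of_ne_zero hK
  have key : ∀ (r : ℕ) (y : Fin (4 * d) → ℝ) (L : ℕ),
      |(moreDigits T (lookupNet d L v) r).eval y 0| ≤ F := by
    intro r
    induction r with
    | zero =>
      intro y L
      simp only [moreDigits, lookupNet, coordLayer, eval]
      rw [interpNet_eval]
      exact abs_interp_le hv _ _
    | succ r ih => exact fun y L => ih _ L
  exact key r _ _

theorem cellNet_weightsBounded {K : ℕ} (hK : K ≠ 0) {T B F : ℝ} {v : ℕ → ℝ}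
    (hv : ∀ n, |v n| ≤ F) (hF : 4 * F ≤ B) (hd : 1 ≤ d) (hT : 2 ^ (K * d) ≤ T) (hB : 2 * T ≤ B) :
    (cellNet d T v K).WeightsBounded B := by
  obtain ⟨r, rfl⟩ := Nat.exists_eq_succ_of_ne_zero hK
  have hT1 : 1 ≤ T := (one_le_pow₀ one_le_two).trans hT
  have hTB : (2 : ℝ) ^ ((r + 1) * d) ≤ B := hT.trans (by linarith)
  have hpow : ∀ i ≤ d, ((2 : ℝ) ^ (r + 1)) ^ i ≤ B := fun i hi => by
    rw [← pow_mul]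
    calc (2 : ℝ) ^ ((r + 1) * i) ≤ 2 ^ ((r + 1) * d) := by gcongr; norm_num
      _ ≤ B := hTB
  refine firstDigit_weightsBounded hT1 hB (moreDigits_weightsBounded hT1 hB ?_ r)
  refine coordLayer_weightsBounded (fun i j => ?_) (fun i => ?_) (by linarith)
    ⟨fun _ i => ?_, fun i => ?_, interpNet_weightsBounded hv hF ?_ (by linarith)⟩
  · have := hpow 1 hd
    rw [pow_one] at this
    fin_cases i; fin_cases j <;> simp <;> linarith
  · fin_cases i; simp; linarith
  · rw [abs_of_nonneg (by positivity)]
    exact hpow i i.2.le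
  · simp; linarith
  · push_cast; exact hTB

theorem floor_two_pow_mul_lt (K : ℕ) {t : ℝ} (ht0 : 0 ≤ t) (ht1 : t < 1) :
    ⌊2 ^ K * t⌋₊ < 2 ^ K := by
  have hM : (0 : ℝ) < 2 ^ K := by positivity
  rw [Nat.floor_lt (by positivity)]
  push_cast
  nlinarith

theorem cellNumber_eq_finFunctionFinEquiv {K : ℕ} {x : Fin d → ℝ} (hx : ∀ i, 0 ≤ x i)
    (hx1 : ∀ i, x i < 1) : cellNumber K x = finFunctionFinEquiv (m := 2 ^ K) (n := d)
      fun i => ⟨⌊2 ^ K * x i⌋₊, floor_two_pow_mul_lt K (hx i) (hx1 i)⟩ := by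
  rw [finFunctionFinEquiv_apply]
  rfl

theorem cellNumber_lt {K : ℕ} {x : Fin d → ℝ} (hx : ∀ i, 0 ≤ x i) (hx1 : ∀ i, x i < 1) :
    cellNumber K x < 2 ^ (K * d) := by
  rw [cellNumber_eq_finFunctionFinEquiv hx hx1, pow_mul]
  exact Fin.is_lt _

end ReLUNet

/-! ### Values on the cells and the exceptional set -/

section

open ReLUNet

variable {d : ℕ}

instance : IsProbabilityMeasure (volume.restrict (unitCube d)) :=
  ⟨by simp [unitCube, Real.volume_Icc_pi]⟩

theorem measurableSet_unitCube : MeasurableSet (unitCube d) := measurableSet_Icc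

/-- A Hölder function is bounded on the cube, also for negative exponents: every
point of the cube has distance at least `1 / 2` to one of the corners `0` and `1`. -/
theorem cubeNorm_top_lt_top (hd : 1 ≤ d) {β Q : ℝ} {f : (Fin d → ℝ) → ℝ} (hQ : 0 ≤ Q)
    (hf : ∀ x ∈ unitCube d, ∀ y ∈ unitCube d, |f x - f y| ≤ Q * ‖x - y‖ ^ β) :
    cubeNorm ∞ f < ∞ := by
  have key : ∀ x ∈ unitCube d,
      ‖f x‖ ≤ |f 0| + |f 1| + Q * max 1 ((1 / 2 : ℝ) ^ β) := by
    intro x hx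
    have hx0 := hx.1
    have hx1 := hx.2
    have hpow : ∀ z : Fin d → ℝ, 1 / 2 ≤ ‖x - z‖ → ‖x - z‖ ≤ 1 →
        ‖x - z‖ ^ β ≤ max 1 ((1 / 2 : ℝ) ^ β) := by
      intro z h1 h2
      rcases le_total 0 β with hβ | hβ
      · exact (Real.rpow_le_one (by linarith) h2 hβ).trans (le_max_left _ _)
      · exact (Real.rpow_le_rpow_of_nonpos (by norm_num) h1 hβ).trans (le_max_right _ _)
    have hcmp : ∀ z ∈ unitCube d, 1 / 2 ≤ ‖x - z‖ →
        |f x| ≤ |f z| + Q * max 1 ((1 / 2 : ℝ) ^ β) := by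
      intro z hz h1
      have h2 : ‖x - z‖ ≤ 1 := by
        refine (pi_norm_le_iff_of_nonneg zero_le_one).2 fun i => ?_
        have := hx0 i
        have := hx1 i
        have := hz.1 i
        have := hz.2 i
        simp only [Pi.zero_apply, Pi.one_apply, Pi.sub_apply, Real.norm_eq_abs] at *
        rw [abs_le]
        constructor <;> linarith
      have h3 := (hf x hx z hz).trans (mul_le_mul_of_nonneg_left (hpow z h1 h2) hQ)
      have h4 := abs_sub_abs_le_abs_sub (f x) (f z)
      linarith
    have hi := norm_le_pi_norm (x - 0) ⟨0, hd⟩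
    have hi' := norm_le_pi_norm (x - 1) ⟨0, hd⟩
    have a0 := abs_nonneg (f 0)
    have a1 := abs_nonneg (f 1)
    simp only [Pi.zero_apply, Pi.one_apply, Pi.sub_apply, Real.norm_eq_abs, sub_zero] at hi hi' ⊢
    rcases le_total (1 / 2) (x ⟨0, hd⟩) with h | h
    · have := hcmp 0 ⟨le_rfl, zero_le_one⟩
        (by rw [sub_zero]; exact h.trans ((le_abs_self _).trans hi))
      linarith
    · have := hcmp 1 ⟨zero_le_one, le_rfl⟩
        (le_trans (by rw [abs_sub_comm]; exact le_trans (by linarith) (le_abs_self _)) hi')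
      linarith
  refine (eLpNorm_le_of_ae_bound (ae_restrict_of_forall_mem measurableSet_unitCube key)).trans_lt ?_
  simp

theorem ae_abs_le_cubeNorm {f : (Fin d → ℝ) → ℝ} (hf : cubeNorm ∞ f < ∞) :
    ∀ᵐ x ∂volume.restrict (unitCube d), |f x| ≤ (cubeNorm ∞ f).toReal := by
  have h := ae_le_eLpNormEssSup (f := f) (μ := volume.restrict (unitCube d))
  rw [← eLpNorm_exponent_top] at h
  filter_upwards [h] with x hx
  rw [← Real.norm_eq_abs, ← toReal_enorm]
  exact ENNReal.toReal_mono hf.ne hx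

/-- The values for the cells, taken at points where `|f| ≤ F`, as there are almost everywhere. -/
theorem exists_cell_values {β Q F : ℝ} {f : (Fin d → ℝ) → ℝ} (hβ : 0 ≤ β) (hQ : 0 ≤ Q)
    (hF : 0 ≤ F)
    (hf : ∀ x ∈ unitCube d, ∀ y ∈ unitCube d, |f x - f y| ≤ Q * ‖x - y‖ ^ β)
    (hfF : ∀ᵐ x ∂volume.restrict (unitCube d), |f x| ≤ F) (K : ℕ) :
    ∃ v : ℕ → ℝ, (∀ n, |v n| ≤ F) ∧ ∀ x ∈ unitCube d, (∀ i, x i < 1) →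
      |f x - v (cellNumber K x)| ≤ Q * (2 : ℝ) ^ (-β * K) := by
  have hM : (0 : ℝ) < 2 ^ K := by positivity
  have hz : ∀ c : Fin d → Fin (2 ^ K), ∃ z ∈ unitCube d,
      (∀ i, ((c i : ℕ) : ℝ) / 2 ^ K < z i ∧ z i < ((c i : ℕ) + 1) / 2 ^ K) ∧ |f z| ≤ F := by
    intro c
    rw [ae_restrict_iff' measurableSet_unitCube] at hfF
    set U : Set (Fin d → ℝ) := Set.pi Set.univ fun i =>
      Set.Ioo (((c i : ℕ) : ℝ) / 2 ^ K) (((c i : ℕ) + 1) / 2 ^ K)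
    have hU : IsOpen U := isOpen_set_pi Set.finite_univ fun i _ => isOpen_Ioo
    have hne : U.Nonempty := Set.univ_pi_nonempty_iff.2 fun i =>
      Set.nonempty_Ioo.2 (by gcongr; linarith)
    obtain ⟨z, hzU, hz⟩ := (Measure.dense_of_ae hfF).inter_open_nonempty U hU hne
    have hzU' : ∀ i, ((c i : ℕ) : ℝ) / 2 ^ K < z i ∧ z i < ((c i : ℕ) + 1) / 2 ^ K :=
      fun i => hzU i trivial
    have hzc : z ∈ unitCube d := by
      refine ⟨fun i => le_trans (by positivity) (hzU' i).1.le,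
        fun i => (hzU' i).2.le.trans ?_⟩
      rw [Pi.one_apply, div_le_one hM]
      exact_mod_cast (c i).2
    exact ⟨z, hzc, hzU', hz hzc⟩
  choose z hzc hzU hzF using hz
  refine ⟨fun n => if h : n < (2 ^ K) ^ d then f (z (finFunctionFinEquiv.symm ⟨n, h⟩)) else 0,
    fun n => ?_, fun x hx hx1 => ?_⟩
  · dsimp only
    split_ifs
    · exact hzF _
    · simpa using hF
  · have hlt : ∀ i, ⌊2 ^ K * x i⌋₊ < 2 ^ K := fun i =>
      floor_two_pow_mul_lt K (hx.1 i) (hx1 i)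
    have hn := cellNumber_eq_finFunctionFinEquiv (K := K) (fun i => hx.1 i) hx1
    simp only [hn, Fin.is_lt, dif_pos, Fin.eta, Equiv.symm_apply_apply]
    set c : Fin d → Fin (2 ^ K) := fun i => ⟨⌊2 ^ K * x i⌋₊, hlt i⟩
    refine (hf x hx _ (hzc c)).trans (mul_le_mul_of_nonneg_left ?_ hQ)
    have hnorm : ‖x - z c‖ ≤ (2 : ℝ) ^ (-(K : ℝ)) := by
      rw [Real.rpow_neg zero_le_two, Real.rpow_natCast]
      refine (pi_norm_le_iff_of_nonneg (by positivity)).2 fun i => ?_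
      obtain ⟨h1, h2⟩ := hzU c i
      have h3 : (⌊2 ^ K * x i⌋₊ : ℝ) ≤ 2 ^ K * x i := Nat.floor_le (mul_nonneg hM.le (hx.1 i))
      have h4 := Nat.lt_floor_add_one (2 ^ K * x i)
      rw [div_lt_iff₀ hM] at h1
      rw [lt_div_iff₀ hM] at h2
      change (⌊2 ^ K * x i⌋₊ : ℝ) < z c i * 2 ^ K at h1
      change z c i * 2 ^ K < (⌊2 ^ K * x i⌋₊ : ℝ) + 1 at h2
      rw [Pi.sub_apply, Real.norm_eq_abs, ← one_div, le_div_iff₀ hM, ← abs_of_pos hM, ← abs_mul,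
        abs_le]
      constructor <;> linarith
    calc ‖x - z c‖ ^ β ≤ ((2 : ℝ) ^ (-(K : ℝ))) ^ β :=
          Real.rpow_le_rpow (norm_nonneg _) hnorm hβ
      _ = 2 ^ (-β * K) := by
          rw [← Real.rpow_mul zero_le_two]
          congr 1
          ring

/-- The points for which some binary digit may be computed wrongly. -/
def exceptionalSet (d K : ℕ) (δ : ℝ) : Set (Fin d → ℝ) :=
  ⋃ q ∈ (Finset.univ : Finset (Fin d)) ×ˢ Finset.range (2 ^ K),
    (fun x : Fin d → ℝ => x q.1) ⁻¹'
      Set.Ico (((q.2 + 1 : ℕ) : ℝ) / 2 ^ K) (((q.2 + 1 : ℕ) : ℝ) / 2 ^ K + δ)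

theorem awayFromGrid_of_notMem_exceptionalSet {K : ℕ} {δ : ℝ} {x : Fin d → ℝ}
    (hx : x ∉ exceptionalSet d K δ) (i : Fin d) : AwayFromGrid K δ (x i) := by
  intro j hj hmem
  exact hx (Set.mem_biUnion (x := (i, j)) (by simpa using hj) hmem)

theorem measurableSet_exceptionalSet (d K : ℕ) (δ : ℝ) :
    MeasurableSet (exceptionalSet d K δ) :=
  Finset.measurableSet_biUnion _ fun q _ => measurable_pi_apply q.1 measurableSet_Ico

theorem volume_cube_slab_le (i : Fin d) (a δ : ℝ) :
    volume.restrict (unitCube d) ((fun x : Fin d → ℝ => x i) ⁻¹' Set.Ico a (a + δ)) ≤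
      ENNReal.ofReal δ := by
  rw [Measure.restrict_apply (measurable_pi_apply i measurableSet_Ico)]
  calc _ ≤ volume (Set.pi Set.univ fun j : Fin d =>
          if j = i then Set.Ico a (a + δ) else Set.Icc (0 : ℝ) 1) := by
        refine measure_mono fun x hx j _ => ?_
        dsimp only
        split_ifs with h
        · exact h ▸ hx.1
        · exact ⟨hx.2.1 j, hx.2.2 j⟩
    _ = ENNReal.ofReal δ := by
        rw [volume_pi_pi, Finset.prod_eq_single i]
        · simp
        · intro j _ h
          simp [h]
        · simp

theorem volume_exceptionalSet_le (d K : ℕ) (δ : ℝ) :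
    volume.restrict (unitCube d) (exceptionalSet d K δ) ≤ ENNReal.ofReal (d * 2 ^ K * δ) := by
  refine (measure_biUnion_finset_le _ _).trans
    ((Finset.sum_le_sum fun q _ => volume_cube_slab_le q.1 _ δ).trans ?_)
  rw [Finset.sum_const, Finset.card_product, Finset.card_univ, Fintype.card_fin,
    Finset.card_range, nsmul_eq_mul, ENNReal.ofReal_mul (by positivity)]
  gcongr
  rw [← ENNReal.ofReal_natCast]
  push_cast
  rfl

/-- With the steepness `T = 2 ^ (K * max d (p * β))` the exceptional set contributes at most
`2 ^ (-β * K)` to the `L^p` norm. -/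
theorem volume_exceptionalSet_rpow_le {d K : ℕ} (hd : 1 ≤ d) (hK : K ≠ 0) {p β T : ℝ} (hp : 0 < p)
    (hT1 : (2 : ℝ) ^ (K * d) ≤ T) (hT2 : (2 : ℝ) ^ (K * (p * β)) ≤ T) :
    volume.restrict (unitCube d) (exceptionalSet d K (T ^ 2)⁻¹) ^ (1 / p) ≤
      ENNReal.ofReal ((2 : ℝ) ^ (-β * K)) := by
  have hd2 : d * 2 ^ K ≤ 2 ^ (K * d) := by
    obtain ⟨c, rfl⟩ := Nat.exists_eq_add_of_le hd
    rw [mul_add, mul_one, pow_add, mul_comm]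
    refine Nat.mul_le_mul_left _ ?_
    calc 1 + c ≤ 2 ^ c := by have := Nat.lt_two_pow_self (n := c); omega
      _ ≤ 2 ^ (K * c) :=
        Nat.pow_le_pow_right two_pos (Nat.le_mul_of_pos_left _ (Nat.pos_of_ne_zero hK))
  have hd3 : (d : ℝ) * 2 ^ K ≤ T := le_trans (by exact_mod_cast hd2) hT1
  have h2 : (0 : ℝ) < 2 ^ (K * (p * β)) := Real.rpow_pos_of_pos two_pos _
  have hT : 0 < T := h2.trans_le hT2
  have key : (d : ℝ) * 2 ^ K * (T ^ 2)⁻¹ ≤ (2 : ℝ) ^ (-β * K * p) := by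
    have e : (2 : ℝ) ^ (-β * K * p) = ((2 : ℝ) ^ (K * (p * β)))⁻¹ := by
      rw [← Real.rpow_neg zero_le_two]
      congr 1
      ring
    rw [e]
    calc (d : ℝ) * 2 ^ K * (T ^ 2)⁻¹ ≤ T * (T ^ 2)⁻¹ := by gcongr
      _ = T⁻¹ := by field_simp
      _ ≤ _ := inv_anti₀ h2 hT2
  calc _ ≤ ENNReal.ofReal ((2 : ℝ) ^ (-β * K * p)) ^ (1 / p) := by
        gcongr
        exact (volume_exceptionalSet_le d K _).trans (ENNReal.ofReal_le_ofReal key)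
    _ = ENNReal.ofReal ((2 : ℝ) ^ (-β * K)) := by
        rw [ENNReal.ofReal_rpow_of_nonneg (by positivity) (by positivity),
          ← Real.rpow_mul zero_le_two]
        congr 2
        field_simp

/-- The `L^p` norm of a function that is at most `a` off a set `Z` and at most `a + b` on it. -/
theorem cubeNorm_le_of_indicator {p a b : ℝ} (hp : 1 ≤ p) (ha : 0 ≤ a) (hb : 0 ≤ b)
    {g : (Fin d → ℝ) → ℝ} {Z : Set (Fin d → ℝ)} (hZ : MeasurableSet Z)
    (hg : ∀ᵐ x ∂volume.restrict (unitCube d), |g x| ≤ a + Z.indicator (fun _ => b) x) :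
    cubeNorm (ENNReal.ofReal p) g ≤
      ENNReal.ofReal a + ENNReal.ofReal b * volume.restrict (unitCube d) Z ^ (1 / p) := by
  have hp0 : ENNReal.ofReal p ≠ 0 := by simp; linarith
  calc cubeNorm (ENNReal.ofReal p) g
      ≤ eLpNorm ((fun _ => a) + Z.indicator fun _ => b) (ENNReal.ofReal p)
          (volume.restrict (unitCube d)) := eLpNorm_mono_ae_real hg
    _ ≤ eLpNorm (fun _ => a) (ENNReal.ofReal p) (volume.restrict (unitCube d)) +
          eLpNorm (Z.indicator fun _ => b) (ENNReal.ofReal p) (volume.restrict (unitCube d)) :=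
        eLpNorm_add_le aestronglyMeasurable_const
          (aestronglyMeasurable_const.indicator hZ) (by simpa using hp)
    _ = _ := by
        rw [eLpNorm_const _ hp0 (IsProbabilityMeasure.ne_zero _),
          eLpNorm_indicator_const hZ hp0 ENNReal.ofReal_ne_top, measure_univ, ENNReal.one_rpow,
          mul_one, ENNReal.toReal_ofReal (by linarith), Real.enorm_of_nonneg ha,
          Real.enorm_of_nonneg hb]

end

theorem mainTheorem1 (d : ℕ) (hd : 1 ≤ d) (K : ℕ) (p : ℝ) (hp : 1 ≤ p) (β : ℝ) (hβ : β ≤ 1)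
    (Q : ℝ) (f : (Fin d → ℝ) → ℝ)
    (hf : ∀ x ∈ unitCube d, ∀ y ∈ unitCube d, |f x - f y| ≤ Q * ‖x - y‖ ^ β) :
    ∃ N : ReLUNet 1 d (hiddenWidths d K),
      N.WeightsBounded
        (2 * max (K : ℝ) (cubeNorm ∞ f).toReal * (2 : ℝ) ^ ((K : ℝ) * max (d : ℝ) (p * β))) ∧
      cubeNorm (ENNReal.ofReal p) (fun x => f x - N.eval x 0) ≤
        ENNReal.ofReal ((16 * Q + 2 * (cubeNorm ∞ f).toReal) * (2 : ℝ) ^ (-β * (K : ℝ))) := by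
  have hQ : 0 ≤ Q := by
    have : Nonempty (Fin d) := ⟨⟨0, hd⟩⟩
    have h := hf 1 ⟨zero_le_one, le_rfl⟩ 0 ⟨le_rfl, zero_le_one⟩
    rw [sub_zero, norm_one, Real.one_rpow, mul_one] at h
    exact (abs_nonneg _).trans h
  have hae := ae_abs_le_cubeNorm (cubeNorm_top_lt_top hd hQ hf)
  set F := (cubeNorm ∞ f).toReal
  have hF : 0 ≤ F := ENNReal.toReal_nonneg
  by_cases htriv : K = 0 ∨ β ≤ 0
  · -- Here `2 ^ (-β * K) ≥ 1`, so that the bound exceeds `‖f‖_∞`.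
    refine ⟨ReLUNet.zeroNet 1 d _, ReLUNet.zeroNet_weightsBounded 1 d _ (by positivity), ?_⟩
    have hpow : 1 ≤ (2 : ℝ) ^ (-β * (K : ℝ)) := by
      refine Real.one_le_rpow one_le_two ?_
      rcases htriv with rfl | h
      · simp
      · exact mul_nonneg (by linarith) (Nat.cast_nonneg _)
    simp only [ReLUNet.zeroNet_eval, Pi.zero_apply, sub_zero]
    refine (eLpNorm_le_of_ae_bound hae).trans ?_
    rw [measure_univ, ENNReal.one_rpow, one_mul]
    refine ENNReal.ofReal_le_ofReal ?_
    nlinarith [mul_nonneg (show (0 : ℝ) ≤ 16 * Q + 2 * F by positivity) (sub_nonneg.2 hpow)]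
  · push Not at htriv
    obtain ⟨hK, hβ0⟩ := htriv
    obtain ⟨v, hv, hfv⟩ := exists_cell_values hβ0.le hQ hF hf hae K
    set T : ℝ := (2 : ℝ) ^ ((K : ℝ) * max (d : ℝ) (p * β)) with hTdef
    have hK1 : (1 : ℝ) ≤ K := by exact_mod_cast Nat.one_le_iff_ne_zero.2 hK
    have hTd : (2 : ℝ) ^ (K * d) ≤ T := by
      rw [← Real.rpow_natCast, Nat.cast_mul]
      exact Real.rpow_le_rpow_of_exponent_le one_le_two (by gcongr; exact le_max_left _ _)
    have hTp : (2 : ℝ) ^ (K * (p * β)) ≤ T :=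
      Real.rpow_le_rpow_of_exponent_le one_le_two (by gcongr; exact le_max_right _ _)
    have hT2 : 2 ≤ T := le_trans (le_self_pow₀ one_le_two (by positivity)) hTd
    have hT0 : 0 < T := by linarith
    refine ⟨ReLUNet.cellNet d T v K, ReLUNet.cellNet_weightsBounded hK hv ?_ hd hTd ?_, ?_⟩
    · nlinarith [le_max_right (K : ℝ) F]
    · nlinarith [le_max_left (K : ℝ) F]
    · have ha : 0 ≤ Q * (2 : ℝ) ^ (-β * (K : ℝ)) := by positivity
      refine (cubeNorm_le_of_indicator (a := Q * (2 : ℝ) ^ (-β * (K : ℝ))) (b := 2 * F) hp ha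
        (by positivity) (measurableSet_exceptionalSet d K (T ^ 2)⁻¹) ?_).trans ?_
      · filter_upwards [hae, ae_restrict_mem measurableSet_unitCube] with x hxF hx
        by_cases hxZ : x ∈ exceptionalSet d K (T ^ 2)⁻¹
        · rw [Set.indicator_of_mem hxZ]
          have h1 := abs_sub (f x) ((ReLUNet.cellNet d T v K).eval x 0)
          have h2 := ReLUNet.abs_cellNet_eval_le hK T hv x
          linarith
        · have haway := awayFromGrid_of_notMem_exceptionalSet hxZ
          have hx1 : ∀ i, x i < 1 := fun i => (haway i).lt_one (by positivity) (hx.2 i)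
          rw [Set.indicator_of_notMem hxZ, add_zero, ReLUNet.cellNet_eval hK hT0 v hx haway,
            ReLUNet.interp_natCast]
          · exact hfv x hx hx1
          · exact (ReLUNet.cellNumber_lt (fun i => hx.1 i) hx1).le
      · calc _ ≤ ENNReal.ofReal (Q * (2 : ℝ) ^ (-β * (K : ℝ))) +
              ENNReal.ofReal (2 * F) * ENNReal.ofReal ((2 : ℝ) ^ (-β * (K : ℝ))) := by
              gcongr
              exact volume_exceptionalSet_rpow_le hd hK (by linarith) hTd hTp
          _ = ENNReal.ofReal ((Q + 2 * F) * (2 : ℝ) ^ (-β * (K : ℝ))) := by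
              rw [← ENNReal.ofReal_mul (by positivity), ← ENNReal.ofReal_add ha (by positivity)]
              congr 1
              ring
          _ ≤ _ := by
              refine ENNReal.ofReal_le_ofReal ?_
              gcongr
              linarith
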